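/- A group is *locally finite* if all its finitely generated subgroups are finite. A metric $d$ on a group $G$ is a *proper left-invariant metric* if $d(g_1g_2,g_1g_3)=d(g_2,g_3)$ for all $g_1,g_2,g_3\in G$ and, for every $K>0$, the set $\{g\in G: d(1_G,g)\le K\}$ is finite. Let $(X,d)$ be a metric space and $s>0$. The $s$-scale connected components of a subset $S\subseteq X$ are the equivalence classes of the relation on $S$ under which $x\sim y$ if there is a finite chain $x=x_0,\dots,x_m=y$ of points of $S$ with $d(x_i,x_{i+1})<s$ for all $i<m$. A function $D$ is an *$n$-dimensional control function* for $(X,d)$ if for every $s>0$ there are sets $U_0,\dots,U_n$ covering $X$ such that every $s$-scale connected component of every $U_i$ has diameter at most $D(s)$. We write $\dim_{AN}(X,d)\le n$ if there is an $n$-dimensional control function of the form $D(s)=Cs$ with $C>0$, and $\operatorname{asdim}_{AN}(X,d)\le n$ if there is one of the form $D(s)=Cs+k$ with $C>0$ and $k\in\mathbb R$; the dimension $\dim_{AN}$, respectively $\operatorname{asdim}_{AN}$, is the least such $n$, and $\infty$ if there is none. **Theorem.** Let $G$ be a countable group whose center is not locally finite (equivalently, the center contains an element of infinite order). Then $G$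 admits a proper left-invariant metric $d_G$ with $\operatorname{asdim}_{AN}(G,d_G)=\infty$. Moreover (the case $G=\mathbb Z$), there is a proper left-invariant metric $d$ on $\mathbb Z$ with $\operatorname{asdim}_{AN}(\mathbb Z,d)=\dim_{AN}(\mathbb Z,d)=\infty$. For this $d$, and for every countable group $\Gamma$ with a proper left-invariant metric $d_\Gamma$, equip $\Gamma\times\mathbb Z$ with the metric $\max(d_\Gamma,d)$; then $\operatorname{asdim}_{AN}(\Gamma\times\mathbb Z)\ne\operatorname{asdim}_{AN}(\Gamma,d_\Gamma)+1$ whenever $\operatorname{asdim}_{AN}(\Gamma,d_\Gamma)<\infty$, and $\dim_{AN}(\Gamma\times\mathbb Z)\ne\dim_{AN}(\Gamma,d_\Gamma)+1$ whenever $\dim_{AN}(\Gamma,d_\Gamma)<\infty$. Both finiteness hypotheses hold, for instance, for the trivial group. Consequently the following two questions of Dranishnikov have negative answers: does $\dim_{AN}(\mathbb Z,d)=1$ for every left-invariant metric $d$ on $\mathbb Z$; and does $\dim_{AN}(\Gamma\times\mathbb Z)=\dim_{AN}(\Gamma)+1$ for every left-invariant metric on $\mathbb Z$? -/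

import Mathlib

universe u v

/-- A group is locally finite if each of its finitely generated subgroups is finite. -/
def IsLocallyFiniteGroup (H : Type u) [Group H] : Prop :=
  ∀ K : Subgroup H, K.FG → Finite K

/-- The metric `m` on the group `G` is a proper left-invariant metric: left translations preserve
distances, and for every `K > 0` only finitely many `g` satisfy `d(1, g) ≤ K`. -/
structure IsProperLeftInvariant {G : Type u} [Group G] (m : MetricSpace G) : Prop where
  left_invariant : ∀ g₁ g₂ g₃ : G, m.dist (g₁ * g₂) (g₁ * g₃) = m.dist g₂ g₃
  proper : ∀ K : ℝ, 0 < K → {g : G | m.dist 1 g ≤ K}.Finite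

/-- The `s`-scale connected component of `x` in `S`: all points of `S` that can be joined to `x` by
a finite chain of points of `S` whose consecutive distances are `< s`. For `x ∈ S` these are exactly
the maximal `s`-scale connected subsets of `S`. -/
def scaleComponent {X : Type u} (m : MetricSpace X) (s : ℝ) (S : Set X) (x : X) : Set X :=
  {y | Relation.ReflTransGen (fun a b => a ∈ S ∧ b ∈ S ∧ m.dist a b < s) x y}

/-- `D` is an `n`-dimensional control function for the metric space `(X, m)`: for every `s > 0`
there is a cover of `X` by `n + 1` sets `U 0, …, U n` such that each `s`-scale connected component
of each `U i` has diameter at most `D s`. -/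
def IsControlFunction {X : Type u} (m : MetricSpace X) (n : ℕ) (D : ℝ → ℝ) : Prop :=
  ∀ s : ℝ, 0 < s → ∃ U : Fin (n + 1) → Set X, (⋃ i, U i) = Set.univ ∧
    ∀ i, ∀ x ∈ U i, ∀ y ∈ scaleComponent m s (U i) x, ∀ z ∈ scaleComponent m s (U i) x,
      m.dist y z ≤ D s

/-- `dim_AN (X, m) ≤ n`: there is an `n`-dimensional control function `s ↦ C * s`, `C > 0`. -/
def DimANLE {X : Type u} (m : MetricSpace X) (n : ℕ) : Prop :=
  ∃ C : ℝ, 0 < C ∧ IsControlFunction m n (fun s => C * s)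

/-- `asdim_AN (X, m) ≤ n`: there is an `n`-dimensional control function `s ↦ C * s + k`, with
constants `C > 0` and `k`. -/
def AsdimANLE {X : Type u} (m : MetricSpace X) (n : ℕ) : Prop :=
  ∃ C k : ℝ, 0 < C ∧ IsControlFunction m n (fun s => C * s + k)

/-- The Assouad-Nagata dimension: the least `n` with `dim_AN (X, m) ≤ n`, and `⊤` if there is
none. -/
noncomputable def dimAN {X : Type u} (m : MetricSpace X) : ℕ∞ :=
  ⨅ (n : ℕ) (_ : DimANLE m n), (n : ℕ∞)

/-- The asymptotic Assouad-Nagata dimension: the least `n` with `asdim_AN (X, m) ≤ n`, and `⊤` if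
there is none. -/
noncomputable def asdimAN {X : Type u} (m : MetricSpace X) : ℕ∞ :=
  ⨅ (n : ℕ) (_ : AsdimANLE m n), (n : ℕ∞)

/-- The metric `max (d₁ (x, x')) (d₂ (y, y'))` on the product of two metric spaces. It is
bi-Lipschitz equivalent to the sum metric, so the choice does not affect the dimensions. -/
noncomputable abbrev prodMetric {X : Type u} {Y : Type v} (m₁ : MetricSpace X) (m₂ : MetricSpace Y) :
    MetricSpace (X × Y) :=
  letI := m₁
  letI := m₂
  Prod.metricSpaceMax

/-! Large, coarse Hamming cubes obstruct linear control. In a cube with edge length `w`, cover `X`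
at scale `3w`: points of one colour at Hamming distance at most 2 share a component, and its
diameter is at most `D w`, where `D` depends only on the slope once `w` exceeds the intercept.
Double counting in `card_le_of_hamming_coloring` then bounds the dimension of the cube. Cubes with
dimension and `w` both unbounded therefore force infinite dimension.

To create them, take `z` central of infinite order and a proper length `l₀`. Let `z ^ t i` cost `2 ^
(L * L)` for `i` in the dyadic block `[2 ^ L, 2 ^ (L + 1))`, and measure elements by their cheapest
expression; the costs tend to infinity, so the length stays proper. Subset sums of `t` over block
`L` span a cube of dimension `2 ^ L`, undistorted because shortcuts fail
(`exists_isProperLength_hamming`). A generator from a later block already costs as much as the whole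
cube. A shortcut with other coefficients in the block leaves a power of `z` to be paid for in `l₀`,
and the fast growth of `t` makes that power too long. -/

/-! ### Colourings of Hamming cubes -/

open Finset in
/-- In a Hamming cube coloured with `n + 1` colours, if points of the same colour at distance at
most `2` share a representative, and representatives are at distance at most `D`, then the
dimension of the cube is bounded in terms of `D` and `n`. -/
theorem card_le_of_hamming_coloring {ι : Type*} [Fintype ι] [DecidableEq ι] (n D : ℕ)
    (c : (ι → Bool) → Fin (n + 1)) (rep : (ι → Bool) → ι → Bool)
    (hD : ∀ x, hammingDist x (rep x) ≤ D)
    (hrep : ∀ x y, c x = c y → hammingDist x y ≤ 2 → rep x = rep y) :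
    Fintype.card ι ≤ D + (n + 1) * (D + 1) := by
  classical
  let flip : (ι → Bool) → ι → ι → Bool := fun x i => Function.update x i (!x i)
  have flip_flip : ∀ x i, flip (flip x i) i = x := by
    intro x i
    simp [flip]
  have dist_flip : ∀ x i, hammingDist x (flip x i) ≤ 1 := by
    intro x i
    refine (card_le_card (t := {i}) ?_).trans (by simp)
    intro j hj
    by_contra hne
    simp only [mem_singleton] at hne
    simp [flip, hne] at hj
  -- Edges leading away from the representative. Within a colour, each `x` starts at least `card ι -
  -- D` of them, and each `y` ends at most `D + 1`.
  let r : (ι → Bool) → (ι → Bool) → Prop := fun x y => ∃ i, y = flip x i ∧ x i = rep x i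
  have key : ∀ a : Fin (n + 1),
      #{x | c x = a} * (Fintype.card ι - D) ≤ #(univ : Finset (ι → Bool)) * (D + 1) := by
    intro a
    refine card_mul_le_card_mul r ?_ ?_
    · intro x _
      have hinj : Function.Injective (flip x) := by
        intro i j hij
        by_contra hne
        have := congrFun hij i
        simp [flip, hne] at this
      have hsub : (univ.filter fun i => x i = rep x i).image (flip x) ⊆
          univ.bipartiteAbove r x := by
        intro y hy
        obtain ⟨i, hi, rfl⟩ := mem_image.1 hy
        simp only [mem_bipartiteAbove, mem_univ, true_and]
        exact ⟨i, rfl, (mem_filter.1 hi).2⟩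
      refine le_trans ?_ (card_le_card hsub)
      rw [card_image_of_injective _ hinj]
      have h1 : #{i | x i = rep x i} + #{i | ¬ x i = rep x i} = Fintype.card ι :=
        card_filter_add_card_filter_not _
      have h2 : #{i | ¬ x i = rep x i} ≤ D := hD x
      omega
    · intro y _
      rcases (bipartiteBelow r {x | c x = a} y).eq_empty_or_nonempty with h | ⟨x₀, hx₀⟩
      · simp [h]
      simp only [mem_bipartiteBelow, mem_filter, mem_univ, true_and] at hx₀
      obtain ⟨hc₀, i₀, hy₀, -⟩ := hx₀
      have hy_dist : hammingDist y (rep x₀) ≤ D + 1 := by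
        have h1 := hammingDist_triangle y x₀ (rep x₀)
        have h2 := dist_flip x₀ i₀
        rw [← hy₀, hammingDist_comm] at h2
        have h3 := hD x₀
        omega
      refine le_trans ?_ hy_dist
      -- All such `x` are neighbours of `y`, so pairwise within distance 2, and share one
      -- representative. Each agrees with it at the flipped coordinate, where `y` therefore differs
      -- from it.
      have hsub : bipartiteBelow r {x | c x = a} y ⊆
          (univ.filter fun i => y i ≠ rep x₀ i).image (flip y) := by
        intro x hx
        simp only [mem_bipartiteBelow, mem_filter, mem_univ, true_and] at hx
        obtain ⟨hc, i, hy, hi⟩ := hx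
        have hrr : rep x = rep x₀ := by
          refine hrep x x₀ (hc.trans hc₀.symm) ?_
          have h1 := hammingDist_triangle x y x₀
          have h2 := dist_flip x₀ i₀
          rw [← hy₀, hammingDist_comm] at h2
          have h3 := dist_flip x i
          rw [← hy] at h3
          omega
        refine mem_image.2 ⟨i, ?_, by rw [hy, flip_flip]⟩
        simp only [mem_filter, mem_univ, true_and]
        rw [← hrr, ← hi, hy]
        simp [flip]
      exact (card_le_card hsub).trans card_image_le
  have hsum : ∑ a : Fin (n + 1), #{x | c x = a} = #(univ : Finset (ι → Bool)) :=
    (card_eq_sum_card_fiberwise fun x _ => mem_coe.2 (mem_univ (c x))).symm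
  have htot : #(univ : Finset (ι → Bool)) * (Fintype.card ι - D) ≤
      #(univ : Finset (ι → Bool)) * ((n + 1) * (D + 1)) := by
    rw [← hsum, sum_mul, hsum]
    refine (sum_le_sum fun a _ => key a).trans ?_
    rw [sum_const, card_univ, Fintype.card_fin, smul_eq_mul]
    exact le_of_eq (by ring)
  have hpos : 0 < #(univ : Finset (ι → Bool)) := card_pos.2 ⟨fun _ => true, mem_univ _⟩
  have := le_of_mul_le_mul_left htot hpos
  omega

/-! ### Infinite dimension and isometric embeddings -/

theorem asdimANLE_of_dimANLE {X : Type*} {m : MetricSpace X} {n : ℕ} (h : DimANLE m n) :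
    AsdimANLE m n := by
  obtain ⟨C, hC, h⟩ := h
  exact ⟨C, 0, hC, by simpa using h⟩

theorem asdimAN_eq_top_iff {X : Type*} {m : MetricSpace X} :
    asdimAN m = ⊤ ↔ ∀ n, ¬ AsdimANLE m n := by
  simp [asdimAN, iInf_eq_top]

theorem dimAN_eq_top_iff {X : Type*} {m : MetricSpace X} :
    dimAN m = ⊤ ↔ ∀ n, ¬ DimANLE m n := by
  simp [dimAN, iInf_eq_top]

theorem dimAN_eq_top_of_asdimAN_eq_top {X : Type*} {m : MetricSpace X} (h : asdimAN m = ⊤) :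
    dimAN m = ⊤ :=
  dimAN_eq_top_iff.2 fun n hn => asdimAN_eq_top_iff.1 h n (asdimANLE_of_dimANLE hn)

/-- Control functions pull back along isometric embeddings. -/
theorem IsControlFunction.comap {X Y : Type*} {mX : MetricSpace X} {mY : MetricSpace Y}
    {n : ℕ} {D : ℝ → ℝ} (h : IsControlFunction mY n D) (f : X → Y)
    (hf : ∀ a b, mY.dist (f a) (f b) = mX.dist a b) : IsControlFunction mX n D := by
  intro s hs
  obtain ⟨U, hU, hdiam⟩ := h s hs
  have lift : ∀ i x y, y ∈ scaleComponent mX s (f ⁻¹' U i) x →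
      f y ∈ scaleComponent mY s (U i) (f x) := by
    intro i x y hy
    refine Relation.ReflTransGen.lift f ?_ _ _ hy
    rintro a b ⟨ha, hb, hab⟩
    exact ⟨ha, hb, by rwa [hf]⟩
  refine ⟨fun i => f ⁻¹' U i, by rw [← Set.preimage_iUnion, hU, Set.preimage_univ], ?_⟩
  intro i x hx y hy z hz
  rw [← hf]
  exact hdiam i (f x) hx _ (lift i x y hy) _ (lift i x z hz)

theorem asdimAN_eq_top_of_isometry {X Y : Type*} {mX : MetricSpace X} {mY : MetricSpace Y}
    (f : X → Y) (hf : ∀ a b, mY.dist (f a) (f b) = mX.dist a b) (h : asdimAN mX = ⊤) :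
    asdimAN mY = ⊤ := by
  rw [asdimAN_eq_top_iff] at h ⊢
  rintro n ⟨C, k, hC, hn⟩
  exact h n ⟨C, k, hC, hn.comap f hf⟩

theorem prodMetric_dist_mk_left {X Y : Type*} (mX : MetricSpace X) (mY : MetricSpace Y) (x : X)
    (a b : Y) : (prodMetric mX mY).dist (x, a) (x, b) = mY.dist a b := by
  let := mX
  let := mY
  change max (dist x x) (dist a b) = dist a b
  simp

/-! ### Hamming cubes force infinite dimension -/

/-- A metric space containing arbitrarily coarse dilated copies of Hamming cubes of arbitrarily
large dimension has infinite asymptotic Assouad-Nagata dimension. -/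
theorem asdimAN_eq_top_of_hamming_cubes {X : Type*} {m : MetricSpace X}
    (h : ∀ N : ℕ, ∃ (s : Finset ℕ) (w : ℕ) (f : (s → Bool) → X), N ≤ s.card ∧ N ≤ w ∧
      ∀ x y, m.dist (f x) (f y) = w * hammingDist x y) : asdimAN m = ⊤ := by
  classical
  rw [asdimAN_eq_top_iff]
  rintro n ⟨C, k, hC, hctrl⟩
  -- At scale `3w` the control is `3Cw + k ≤ (3C + 1)w`, as `k ≤ w`.
  obtain ⟨D, hD⟩ := exists_nat_ge (3 * C + 1)
  obtain ⟨k', hk'⟩ := exists_nat_ge k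
  obtain ⟨s, w, f, hs, hw, hf⟩ := h (D + (n + 1) * (D + 1) + 1 + k')
  have hw0 : (0 : ℝ) < w := by exact_mod_cast (show 0 < w by omega)
  have hkw : k ≤ w := hk'.trans (by exact_mod_cast (show k' ≤ w by omega))
  obtain ⟨U, hU, hdiam⟩ := hctrl (3 * w) (by positivity)
  have hcov : ∀ x : s → Bool, ∃ i, f x ∈ U i := fun x => by
    have : f x ∈ ⋃ i, U i := hU ▸ Set.mem_univ _
    simpa using this
  choose c hc using hcov
  let R : (s → Bool) → (s → Bool) → Prop := fun x y => c x = c y ∧ hammingDist x y ≤ 2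
  let S : Setoid (s → Bool) := Relation.EqvGen.setoid R
  -- One point per class of the closure of `R`; each class stays within one colour and one
  -- `3w`-component.
  let rep : (s → Bool) → s → Bool := fun x => (Quotient.mk S x).out
  have hcomp : ∀ x y, Relation.EqvGen R x y → c x = c y ∧
      f y ∈ scaleComponent m (3 * w) (U (c x)) (f x) ∧
      f x ∈ scaleComponent m (3 * w) (U (c x)) (f y) := by
    intro x y hxy
    induction hxy with
    | rel x y hxy =>
      have hd : m.dist (f x) (f y) < 3 * w := by
        rw [hf]
        have : (hammingDist x y : ℝ) ≤ 2 := by exact_mod_cast hxy.2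
        nlinarith
      have hy : f y ∈ U (c x) := hxy.1 ▸ hc y
      refine ⟨hxy.1, Relation.ReflTransGen.single ⟨hc x, hy, hd⟩,
        Relation.ReflTransGen.single ⟨hy, hc x, ?_⟩⟩
      rwa [m.dist_comm]
    | refl x => exact ⟨rfl, Relation.ReflTransGen.refl, Relation.ReflTransGen.refl⟩
    | symm x y _ ih => exact ⟨ih.1.symm, ih.1 ▸ ih.2.2, ih.1 ▸ ih.2.1⟩
    | trans x y z _ _ ih₁ ih₂ =>
      rw [← ih₁.1] at ih₂
      exact ⟨ih₂.1, ih₁.2.1.trans ih₂.2.1, ih₂.2.2.trans ih₁.2.2⟩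
  have hbound := card_le_of_hamming_coloring n D c rep ?_ ?_
  · rw [Fintype.card_coe] at hbound
    omega
  · intro x
    have hx : Relation.EqvGen R x (rep x) :=
      Relation.EqvGen.symm _ _ (Quotient.mk_out (s := S) x)
    have h1 := hdiam (c x) (f x) (hc x) _ Relation.ReflTransGen.refl _ (hcomp _ _ hx).2.1
    rw [hf] at h1
    have h2 : (w : ℝ) * hammingDist x (rep x) ≤ w * D := by nlinarith
    exact_mod_cast le_of_mul_le_mul_left h2 hw0
  · intro x y hxy hd
    exact congrArg Quotient.out
      (Quotient.sound (s := S) (Relation.EqvGen.rel _ _ ⟨hxy, hd⟩))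

/-! ### Proper length functions -/

/-- A proper length function on a group, with values in `ℕ`. -/
structure IsProperLength {G : Type*} [Group G] (l : G → ℕ) : Prop where
  map_one : l 1 = 0
  eq_one : ∀ g, l g = 0 → g = 1
  map_inv_le : ∀ g, l g⁻¹ ≤ l g
  map_mul_le : ∀ g h, l (g * h) ≤ l g + l h
  finite : ∀ K, {g | l g ≤ K}.Finite

/-- The left-invariant metric of a proper length function. -/
@[reducible]
noncomputable def IsProperLength.metric {G : Type*} [Group G] {l : G → ℕ}
    (hl : IsProperLength l) : MetricSpace G where
  dist g h := l (g⁻¹ * h)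
  dist_self g := by simp [hl.map_one]
  dist_comm g h := by
    have key : ∀ g h : G, l (g⁻¹ * h) ≤ l (h⁻¹ * g) := fun g h => by
      simpa using hl.map_inv_le (h⁻¹ * g)
    exact_mod_cast le_antisymm (key g h) (key h g)
  dist_triangle g h k := by
    have := hl.map_mul_le (g⁻¹ * h) (h⁻¹ * k)
    rw [show g⁻¹ * h * (h⁻¹ * k) = g⁻¹ * k by group] at this
    exact_mod_cast this
  eq_of_dist_eq_zero {g h} hgh := by
    have := hl.eq_one (g⁻¹ * h) (by exact_mod_cast hgh)
    exact (inv_mul_eq_one.1 this)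

theorem IsProperLength.metric_dist {G : Type*} [Group G] {l : G → ℕ} (hl : IsProperLength l)
    (g h : G) : hl.metric.dist g h = l (g⁻¹ * h) := rfl

theorem IsProperLength.isProperLeftInvariant_metric {G : Type*} [Group G] {l : G → ℕ}
    (hl : IsProperLength l) : IsProperLeftInvariant hl.metric where
  left_invariant g h k := by
    simp only [metric_dist]
    rw [show (g * h)⁻¹ * (g * k) = h⁻¹ * k by group]
  proper K hK := by
    refine (hl.finite ⌊K⌋₊).subset fun g hg => ?_
    have hg' : (l (1⁻¹ * g) : ℝ) ≤ K := hg
    rw [inv_one, one_mul] at hg'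
    exact Nat.le_floor hg'

/-- A cost function on a monoid mapping onto a group induces the quotient length function. -/
theorem exists_isProperLength_of_cost {M G : Type*} [Monoid M] [Group G] (f : M →* G)
    (hf : Function.Surjective f) (c : M → ℕ) (c_one : c 1 = 0)
    (c_eq_zero : ∀ a, c a = 0 → f a = 1) (c_inv : ∀ a, ∃ b, f b = (f a)⁻¹ ∧ c b ≤ c a)
    (c_mul : ∀ a b, c (a * b) ≤ c a + c b) (c_finite : ∀ K, (f '' {a | c a ≤ K}).Finite) :
    ∃ l : G → ℕ, IsProperLength l ∧ (∀ a, l (f a) ≤ c a) ∧ ∀ g, ∃ a, f a = g ∧ c a = l g := by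
  let l : G → ℕ := fun g => sInf (c '' (f ⁻¹' {g}))
  have l_le : ∀ a, l (f a) ≤ c a := fun a => Nat.sInf_le ⟨a, rfl, rfl⟩
  have l_attained : ∀ g, ∃ a, f a = g ∧ c a = l g := fun g => by
    obtain ⟨b, hb⟩ := hf g
    obtain ⟨a, ha, hca⟩ := Nat.sInf_mem (s := c '' (f ⁻¹' {g})) ⟨c b, b, hb, rfl⟩
    exact ⟨a, ha, hca⟩
  refine ⟨l, ⟨?_, ?_, ?_, ?_, ?_⟩, l_le, l_attained⟩
  · have := l_le 1
    rw [map_one, c_one] at this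
    omega
  · intro g hg
    obtain ⟨a, rfl, ha⟩ := l_attained g
    exact c_eq_zero a (ha.trans hg)
  · intro g
    obtain ⟨a, rfl, ha⟩ := l_attained g
    obtain ⟨b, hb, hba⟩ := c_inv a
    rw [← ha, ← hb]
    exact (l_le b).trans hba
  · intro g h
    obtain ⟨a, rfl, ha⟩ := l_attained g
    obtain ⟨b, rfl, hb⟩ := l_attained h
    rw [← ha, ← hb, ← map_mul]
    exact (l_le _).trans (c_mul a b)
  · intro K
    refine (c_finite K).subset fun g hg => ?_
    obtain ⟨a, ha, hca⟩ := l_attained g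
    exact ⟨a, hca.trans_le hg, ha⟩

/-- The length of the shortest weighted word representing an element. -/
theorem exists_isProperLength (G : Type*) [Group G] [Countable G] :
    ∃ l : G → ℕ, IsProperLength l := by
  obtain ⟨enc, henc⟩ := exists_injective_nat G
  -- Symmetric under inversion; the `+ 1` lets the cost of a word bound its number of letters.
  let w : G → ℕ := fun g => enc g + enc g⁻¹ + 1
  have w_inv : ∀ g, w g⁻¹ = w g := fun g => by simp only [w, inv_inv]; omega
  have w_finite : ∀ K, {g | w g ≤ K}.Finite := fun K => by
    refine ((Set.finite_le_nat K).preimage henc.injOn).subset fun g hg => ?_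
    simp only [Set.mem_ofPred_eq, w, Set.mem_preimage] at hg ⊢
    omega
  let c : FreeMonoid G → ℕ := fun a => (a.toList.map w).sum
  refine (exists_isProperLength_of_cost (FreeMonoid.lift (id : G → G))
    (fun g => ⟨FreeMonoid.of g, by simp⟩) c (by simp [c]) ?_ ?_ ?_ ?_).imp
    fun l hl => hl.1
  · intro a ha
    cases a using FreeMonoid.casesOn with
    | one => simp
    | of_mul x xs => simp [c, w] at ha
  · intro a
    refine ⟨FreeMonoid.ofList (a.toList.map fun g => g⁻¹).reverse, ?_, ?_⟩
    · simp [FreeMonoid.lift_apply, List.prod_inv_reverse]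
    · simp [c, List.map_reverse, Function.comp_def, w_inv]
  · simp [c]
  · intro K
    have hfin : {a : List {g // w g ≤ K} | a.length ≤ K}.Finite := by
      have : Finite {g // w g ≤ K} := w_finite K
      exact List.finite_length_le _ _
    refine (hfin.image fun a => (a.map Subtype.val).prod).subset ?_
    rintro _ ⟨a, ha, rfl⟩
    have hle : ∀ g ∈ a.toList, w g ≤ K := fun g hg =>
      (List.le_sum_of_mem (List.mem_map_of_mem hg)).trans ha
    refine ⟨a.toList.pmap Subtype.mk hle, ?_, by simp [FreeMonoid.lift_apply, List.map_pmap]⟩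
    · simp only [Set.mem_ofPred_eq, List.length_pmap]
      refine le_trans ?_ ha
      have := List.length_le_sum_of_one_le (a.toList.map w) (by
        intro i hi
        obtain ⟨g, -, rfl⟩ := List.mem_map.1 hi
        exact Nat.le_add_left _ _)
      simpa using this

/-! ### Fast-growing sequences and weighted norms -/

/-- A sequence of integers growing as fast as prescribed relative to its partial sums. -/
theorem exists_fast_growing (K B : ℕ → ℕ) :
    ∃ t : ℕ → ℕ, ∀ i, (1 + K i) * ∑ j ∈ Finset.range i, t j + B i ≤ t i := by
  -- `S i` is the partial sum of the sequence, so the recursion needs only its last value.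
  let S : ℕ → ℕ := fun i => Nat.rec 0 (fun i s => s + ((1 + K i) * s + B i)) i
  have hS : ∀ i, ∑ j ∈ Finset.range i, ((1 + K j) * S j + B j) = S i := by
    intro i
    induction i with
    | zero => rfl
    | succ i ih => rw [Finset.sum_range_succ, ih]
  exact ⟨fun i => (1 + K i) * S i + B i, fun i => by rw [hS]⟩

/-- The `ℓ¹`-norm with weights `w` on finitely supported integer sequences. -/
noncomputable def weightedNorm (w : ℕ → ℕ) (m : ℕ →₀ ℤ) : ℕ :=
  m.sum fun i k => k.natAbs * w i

theorem weightedNorm_eq_sum (w : ℕ → ℕ) {m : ℕ →₀ ℤ} {s : Finset ℕ} (hs : m.support ⊆ s) :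
    weightedNorm w m = ∑ i ∈ s, (m i).natAbs * w i :=
  Finsupp.sum_of_support_subset _ hs _ (by simp)

theorem sum_le_weightedNorm (w : ℕ → ℕ) (m : ℕ →₀ ℤ) (s : Finset ℕ) :
    ∑ i ∈ s, (m i).natAbs * w i ≤ weightedNorm w m := by
  classical
  rw [weightedNorm_eq_sum w (Finset.subset_union_left (s₂ := s))]
  exact Finset.sum_le_sum_of_subset Finset.subset_union_right

theorem le_weightedNorm (w : ℕ → ℕ) (m : ℕ →₀ ℤ) (i : ℕ) :
    (m i).natAbs * w i ≤ weightedNorm w m := by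
  simpa using sum_le_weightedNorm w m {i}

theorem weightedNorm_zero (w : ℕ → ℕ) : weightedNorm w 0 = 0 := by simp [weightedNorm]

theorem weightedNorm_neg (w : ℕ → ℕ) (m : ℕ →₀ ℤ) :
    weightedNorm w (-m) = weightedNorm w m := by
  rw [weightedNorm_eq_sum w (Finsupp.support_neg m).subset,
    weightedNorm_eq_sum w (Finset.Subset.refl m.support)]
  simp

theorem weightedNorm_add_le (w : ℕ → ℕ) (m n : ℕ →₀ ℤ) :
    weightedNorm w (m + n) ≤ weightedNorm w m + weightedNorm w n := by
  classical
  rw [weightedNorm_eq_sum w Finsupp.support_add,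
    weightedNorm_eq_sum w (Finset.subset_union_left (s₂ := n.support)),
    weightedNorm_eq_sum w (Finset.subset_union_right (s₁ := m.support)),
    ← Finset.sum_add_distrib]
  refine Finset.sum_le_sum fun i _ => ?_
  rw [← add_mul]
  exact Nat.mul_le_mul_right _ (Int.natAbs_add_le _ _)

theorem eq_zero_of_weightedNorm_eq_zero {w : ℕ → ℕ} (hw : ∀ i, 0 < w i) {m : ℕ →₀ ℤ}
    (hm : weightedNorm w m = 0) : m = 0 := by
  ext i
  have h := le_weightedNorm w m i
  rw [hm] at h
  have h' := Nat.mul_eq_zero.1 (Nat.le_zero.1 h)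
  rcases h' with h' | h'
  · simpa using h'
  · exact absurd h' (hw i).ne'

/-- A bounded norm confines the support to the finitely many indices of small weight and, as weights
are at least 1, also bounds the coefficients. -/
theorem finite_weightedNorm_le {w : ℕ → ℕ} (hw : ∀ i, 0 < w i)
    (hfin : ∀ K, {i | w i ≤ K}.Finite) (K : ℕ) : {m | weightedNorm w m ≤ K}.Finite := by
  classical
  refine ((hfin K).toFinset.finsupp fun _ => Finset.Icc (-(K : ℤ)) K).finite_toSet.subset
    fun m hm => ?_
  rw [Finset.mem_coe, Finset.mem_finsupp_iff]
  have key : ∀ i, (m i).natAbs * w i ≤ K := fun i => (le_weightedNorm w m i).trans hm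
  refine ⟨fun i hi => ?_, fun i _ => ?_⟩
  · have h0 : 0 < (m i).natAbs := Int.natAbs_pos.2 (Finsupp.mem_support_iff.1 hi)
    simpa using (Nat.le_mul_of_pos_left (w i) h0).trans (key i)
  · have := (Nat.le_mul_of_pos_right (m i).natAbs (hw i)).trans (key i)
    rw [Finset.mem_Icc]
    omega

/-- The indicator of a subset of `s`, as a finitely supported integer sequence. -/
noncomputable def subsetIndicator {s : Finset ℕ} (x : s → Bool) : ℕ →₀ ℤ :=
  Finsupp.indicator s fun i hi => if x ⟨i, hi⟩ then 1 else 0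

theorem subsetIndicator_of_mem {s : Finset ℕ} (x : s → Bool) {i : ℕ} (hi : i ∈ s) :
    subsetIndicator x i = if x ⟨i, hi⟩ then 1 else 0 :=
  Finsupp.indicator_of_mem hi _

theorem subsetIndicator_of_notMem {s : Finset ℕ} (x : s → Bool) {i : ℕ} (hi : i ∉ s) :
    subsetIndicator x i = 0 :=
  Finsupp.indicator_of_notMem hi _

/-- Accounts for the `1` in the growth factor `1 + K i`. -/
theorem natAbs_subsetIndicator_sub_le {s : Finset ℕ} (x y : s → Bool) (i : ℕ) :
    ((subsetIndicator y - subsetIndicator x) i).natAbs ≤ 1 := by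
  rw [Finsupp.sub_apply]
  by_cases hi : i ∈ s
  · rw [subsetIndicator_of_mem _ hi, subsetIndicator_of_mem _ hi]
    split_ifs <;> simp
  · rw [subsetIndicator_of_notMem _ hi, subsetIndicator_of_notMem _ hi]
    simp

theorem weightedNorm_subsetIndicator_sub {w : ℕ → ℕ} {s : Finset ℕ} {b : ℕ}
    (hb : ∀ i ∈ s, w i = b) (x y : s → Bool) :
    weightedNorm w (subsetIndicator y - subsetIndicator x) = b * hammingDist x y := by
  have hsupp : (subsetIndicator y - subsetIndicator x).support ⊆ s := by
    intro i hi
    by_contra his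
    simp [subsetIndicator_of_notMem _ his] at hi
  rw [weightedNorm_eq_sum w hsupp, ← Finset.sum_attach, hammingDist, Finset.card_filter,
    Finset.mul_sum]
  refine Finset.sum_congr rfl fun i _ => ?_
  rw [Finsupp.sub_apply, subsetIndicator_of_mem _ i.2, subsetIndicator_of_mem _ i.2, hb i i.2]
  cases x i <;> cases y i <;> simp

/-! ### Lengths with cheap central powers -/

/-- If the integer sequence `t` grows fast, then the combination of `t` with small coefficients `h`
is at least as large as prescribed at the last index of the support of `h`. -/
theorem le_natAbs_linearCombination {K B t : ℕ → ℕ}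
    (ht : ∀ i, (1 + K i) * ∑ j ∈ Finset.range i, t j + B i ≤ t i) {h : ℕ →₀ ℤ} {i : ℕ}
    (hi : h i ≠ 0) (hgt : ∀ j, i < j → h j = 0) (hle : ∀ j < i, (h j).natAbs ≤ 1 + K i) :
    B i ≤ (Finsupp.linearCombination ℤ (fun j => (t j : ℤ)) h).natAbs := by
  have hsupp : h.support ⊆ Finset.range (i + 1) := by
    intro j hj
    by_contra hji
    exact Finsupp.mem_support_iff.1 hj (hgt j (by simpa using hji))
  rw [Finsupp.linearCombination_apply, Finsupp.sum_of_support_subset _ hsupp _ (by simp),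
    Finset.sum_range_succ]
  set r : ℤ := ∑ j ∈ Finset.range i, h j • (t j : ℤ) with hr
  have h1 : |r| ≤ (1 + K i) * ∑ j ∈ Finset.range i, (t j : ℤ) := by
    rw [hr, Finset.mul_sum]
    refine (Finset.abs_sum_le_sum_abs _ _).trans (Finset.sum_le_sum fun j hj => ?_)
    rw [smul_eq_mul, abs_mul, Nat.abs_cast]
    refine mul_le_mul_of_nonneg_right ?_ (Nat.cast_nonneg _)
    have := hle j (Finset.mem_range.1 hj)
    rw [Int.abs_eq_natAbs]
    exact_mod_cast this
  have h2 : (t i : ℤ) ≤ |h i • (t i : ℤ)| := by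
    rw [smul_eq_mul, abs_mul, Nat.abs_cast]
    exact le_mul_of_one_le_left (Nat.cast_nonneg _) (Int.one_le_abs hi)
  have h3 : ((1 + K i) * ∑ j ∈ Finset.range i, (t j : ℤ)) + B i ≤ t i := by exact_mod_cast ht i
  have h4 := abs_sub_abs_le_abs_add (h i • (t i : ℤ)) r
  rw [add_comm] at h4
  zify
  linarith

/-- The product map `G × ℤ^(ℕ) → G` sending the basis vectors of `ℤ^(ℕ)` to powers of a central
element. -/
noncomputable def centralPowHom {G : Type*} [Group G] (z : G) (hz : z ∈ Subgroup.center G)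
    (t : ℕ → ℕ) : G × Multiplicative (ℕ →₀ ℤ) →* G where
  toFun a := a.1 * z ^ Finsupp.linearCombination ℤ (fun j => (t j : ℤ)) a.2.toAdd
  map_one' := by simp
  map_mul' a b := by
    have hc : ∀ (k : ℤ) (g : G), z ^ k * g = g * z ^ k := fun k g =>
      (Subgroup.mem_center_iff.1 (Subgroup.zpow_mem _ hz k) g).symm
    simp only [Prod.fst_mul, Prod.snd_mul, toAdd_mul, map_add, zpow_add]
    rw [mul_assoc, mul_assoc, ← mul_assoc b.1, ← hc _ b.1, mul_assoc]

theorem centralPowHom_apply {G : Type*} [Group G] (z : G) (hz : z ∈ Subgroup.center G)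
    (t : ℕ → ℕ) (g : G) (m : Multiplicative (ℕ →₀ ℤ)) : centralPowHom z hz t (g, m) =
      g * z ^ Finsupp.linearCombination ℤ (fun j => (t j : ℤ)) m.toAdd := rfl

/-- A proper length on `G` for which the powers `z ^ t i` of the central element `z` have length at
most `w i`. -/
theorem exists_isProperLength_centralPow {G : Type*} [Group G] {l₀ : G → ℕ}
    (hl₀ : IsProperLength l₀) {z : G} (hz : z ∈ Subgroup.center G) (t : ℕ → ℕ) {w : ℕ → ℕ}
    (hw : ∀ i, 0 < w i) (hfin : ∀ K, {i | w i ≤ K}.Finite) :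
    ∃ l : G → ℕ, IsProperLength l ∧
      (∀ m, l (z ^ Finsupp.linearCombination ℤ (fun j => (t j : ℤ)) m) ≤ weightedNorm w m) ∧
      ∀ g, ∃ g₀ m, g₀ * z ^ Finsupp.linearCombination ℤ (fun j => (t j : ℤ)) m = g ∧
        l₀ g₀ + weightedNorm w m = l g := by
  refine (exists_isProperLength_of_cost (centralPowHom z hz t)
    (fun g => ⟨(g, 1), by simp [centralPowHom_apply]⟩)
    (fun a => l₀ a.1 + weightedNorm w a.2.toAdd) ?_ ?_ ?_ ?_ ?_).imp
    fun l ⟨hl, hle, hatt⟩ => ⟨hl, fun m => ?_, fun g => ?_⟩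
  · simp [hl₀.map_one, weightedNorm_zero]
  · rintro ⟨g, m⟩ h
    have h1 := hl₀.eq_one g (by simp only at h; omega)
    have h2 : m.toAdd = 0 := eq_zero_of_weightedNorm_eq_zero hw (by simp only at h; omega)
    simp [centralPowHom_apply, h1, h2]
  · rintro a
    refine ⟨a⁻¹, map_inv _ _, ?_⟩
    simp only [Prod.fst_inv, Prod.snd_inv, toAdd_inv, weightedNorm_neg]
    exact Nat.add_le_add_right (hl₀.map_inv_le _) _
  · intro a b
    have h1 := hl₀.map_mul_le a.1 b.1
    have h2 := weightedNorm_add_le w a.2.toAdd b.2.toAdd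
    simp only [Prod.fst_mul, Prod.snd_mul, toAdd_mul]
    omega
  · intro K
    refine Set.Finite.image _ (((hl₀.finite K).prod ((finite_weightedNorm_le hw hfin K).preimage
      Multiplicative.toAdd.injective.injOn)).subset fun a ha => ?_)
    simp only [Set.mem_ofPred_eq] at ha
    exact ⟨show l₀ a.1 ≤ K by omega, show weightedNorm w a.2.toAdd ≤ K by omega⟩
  · simpa [centralPowHom_apply, hl₀.map_one] using hle (1, Multiplicative.ofAdd m)
  · obtain ⟨⟨g₀, m⟩, h, h'⟩ := hatt g
    exact ⟨g₀, m.toAdd, h, h'⟩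

/-- The large powers of an element of infinite order are long. -/
theorem IsProperLength.exists_le_zpow {G : Type*} [Group G] {l : G → ℕ} (hl : IsProperLength l)
    {z : G} (hz : ¬ IsOfFinOrder z) (K : ℕ) :
    ∃ B : ℕ, ∀ y : ℤ, B ≤ y.natAbs → K ≤ l (z ^ y) := by
  have hfin : {y : ℤ | l (z ^ y) ≤ K}.Finite :=
    (hl.finite K).preimage (injective_zpow_iff_not_isOfFinOrder.2 hz).injOn
  obtain ⟨B, hB⟩ := (hfin.image Int.natAbs).bddAbove
  refine ⟨B + 1, fun y hy => ?_⟩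
  by_contra hlt
  have := hB ⟨y, show l (z ^ y) ≤ K by omega, rfl⟩
  omega

/-! ### Dyadic blocks and undistorted cubes -/

/-- The weight of the dyadic block containing an index. -/
def blockWeight (i : ℕ) : ℕ := 2 ^ (Nat.log 2 i * Nat.log 2 i)

theorem blockWeight_pos (i : ℕ) : 0 < blockWeight i := by unfold blockWeight; positivity

theorem finite_blockWeight_le (K : ℕ) : {i | blockWeight i ≤ K}.Finite := by
  refine (Set.finite_lt_nat (2 ^ (K + 1))).subset fun i hi => ?_
  simp only [Set.mem_ofPred_eq, blockWeight] at hi ⊢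
  refine Nat.lt_pow_of_log_lt (by norm_num) ?_
  have h1 := (Nat.lt_two_pow_self (n := Nat.log 2 i * Nat.log 2 i)).trans_le hi
  have h2 := Nat.le_mul_self (Nat.log 2 i)
  omega

theorem log_eq_of_mem_block {L i : ℕ} (hi : i ∈ Finset.Ico (2 ^ L) (2 ^ (L + 1))) :
    Nat.log 2 i = L := by
  rw [Finset.mem_Ico] at hi
  exact (Nat.log_eq_iff (by right; constructor <;> [norm_num; exact (lt_of_lt_of_le (by positivity) hi.1).ne'])).2 hi

/-- Since `(L + 1)² ≥ L + L²`, one later generator costs at least `2 ^ L` generators of block `L`.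
-/
theorem le_blockWeight_of_block_le {L i : ℕ} (hi : 2 ^ (L + 1) ≤ i) :
    2 ^ L * 2 ^ (L * L) ≤ blockWeight i := by
  have h : L + 1 ≤ Nat.log 2 i := Nat.le_log_of_pow_le (by norm_num) hi
  rw [blockWeight, ← pow_add]
  refine Nat.pow_le_pow_right (by norm_num) ?_
  have := Nat.mul_le_mul h h
  nlinarith

/-- If `z` is central of infinite order, then `G` has a proper length whose left-invariant metric
restricts to dilated Hamming metrics on cubes spanned by powers of `z`. -/
theorem exists_isProperLength_hamming {G : Type*} [Group G] [Countable G] {z : G}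
    (hz : z ∈ Subgroup.center G) (hz' : ¬ IsOfFinOrder z) :
    ∃ (l : G → ℕ) (t : ℕ → ℕ), IsProperLength l ∧
      ∀ (L : ℕ) (x y : Finset.Ico (2 ^ L) (2 ^ (L + 1)) → Bool),
        l (z ^ Finsupp.linearCombination ℤ (fun j => (t j : ℤ))
          (subsetIndicator y - subsetIndicator x)) = 2 ^ (L * L) * hammingDist x y := by
  obtain ⟨l₀, hl₀⟩ := exists_isProperLength G
  -- Bounds the diameter of the cube on the block of `i`: number of coordinates times edge length.
  let K : ℕ → ℕ := fun i => 2 ^ Nat.log 2 i * 2 ^ (Nat.log 2 i * Nat.log 2 i)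
  choose B hB using fun i => hl₀.exists_le_zpow hz' (K i)
  obtain ⟨t, ht⟩ := exists_fast_growing K B
  obtain ⟨l, hl, hle, hatt⟩ := exists_isProperLength_centralPow hl₀ hz t blockWeight_pos
    finite_blockWeight_le
  refine ⟨l, t, hl, fun L x y => ?_⟩
  have hnorm : weightedNorm blockWeight (subsetIndicator y - subsetIndicator x) =
      2 ^ (L * L) * hammingDist x y :=
    weightedNorm_subsetIndicator_sub
      (fun i hi => by rw [blockWeight, log_eq_of_mem_block hi]) x y
  have hKL : 2 ^ (L * L) * hammingDist x y ≤ 2 ^ L * 2 ^ (L * L) := by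
    rw [mul_comm]
    refine Nat.mul_le_mul_right _ (hammingDist_le_card_fintype.trans_eq ?_)
    rw [Fintype.card_coe, Nat.card_Ico, pow_succ]
    omega
  set e := subsetIndicator y - subsetIndicator x with he
  have e_eq_zero : ∀ i ∉ Finset.Ico (2 ^ L) (2 ^ (L + 1)), e i = 0 := fun i hi => by
    rw [he, Finsupp.sub_apply, subsetIndicator_of_notMem _ hi, subsetIndicator_of_notMem _ hi,
      sub_zero]
  have e_le : ∀ i, (e i).natAbs ≤ 1 := natAbs_subsetIndicator_sub_le x y
  rw [← hnorm] at hKL ⊢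
  refine le_antisymm (hle e) ?_
  by_contra! hlt
  obtain ⟨g₀, m, hg, hcost⟩ := hatt (z ^ Finsupp.linearCombination ℤ (fun j => (t j : ℤ)) e)
  have hm : weightedNorm blockWeight m < weightedNorm blockWeight e := by omega
  have hg₀ : g₀ = z ^ Finsupp.linearCombination ℤ (fun j => (t j : ℤ)) (e - m) := by
    rw [map_sub, zpow_sub, ← hg, mul_inv_cancel_right]
  have m_le : ∀ i, (m i).natAbs * blockWeight i < 2 ^ L * 2 ^ (L * L) := fun i =>
    (le_weightedNorm _ m i).trans_lt (hm.trans_le hKL)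
  have high : ∀ i, 2 ^ (L + 1) ≤ i → (e - m) i = 0 := by
    intro i hi
    have h1 : m i = 0 := by
      by_contra h0
      have h2 := Nat.le_mul_of_pos_left (blockWeight i) (Int.natAbs_pos.2 h0)
      have h3 := le_blockWeight_of_block_le hi
      have h4 := m_le i
      omega
    rw [Finsupp.sub_apply, h1, e_eq_zero i (by simp [hi]), sub_zero]
  -- If `m` agreed with `e` on the block, it would cost at least as much as `e`.
  have hblock : ∃ i ∈ Finset.Ico (2 ^ L) (2 ^ (L + 1)), (e - m) i ≠ 0 := by
    by_contra! h
    refine hm.not_ge (le_trans (le_of_eq ?_) (sum_le_weightedNorm blockWeight m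
      (Finset.Ico (2 ^ L) (2 ^ (L + 1)))))
    rw [weightedNorm_eq_sum blockWeight (m := e) (s := Finset.Ico (2 ^ L) (2 ^ (L + 1)))]
    · refine Finset.sum_congr rfl fun i hi => ?_
      rw [sub_eq_zero.1 ((Finsupp.sub_apply e m i).symm.trans (h i hi))]
    · intro i hi
      by_contra hi'
      exact Finsupp.mem_support_iff.1 hi (e_eq_zero i hi')
  obtain ⟨i₀, hi₀, hne₀⟩ := hblock
  have hne : (e - m).support.Nonempty := ⟨i₀, Finsupp.mem_support_iff.2 hne₀⟩
  -- The top index lies in the block by `high` and `hi₀`. Below it `m` is known only to have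
  -- coefficients at most `K i`, which the growth of `t` absorbs.
  set i := (e - m).support.max' hne with hi_def
  have hi : (e - m) i ≠ 0 := Finsupp.mem_support_iff.1 (Finset.max'_mem _ hne)
  have hi_block : i ∈ Finset.Ico (2 ^ L) (2 ^ (L + 1)) := by
    rw [Finset.mem_Ico] at hi₀ ⊢
    refine ⟨hi₀.1.trans (Finset.le_max' _ _ (Finsupp.mem_support_iff.2 hne₀)), ?_⟩
    by_contra! h
    exact hi (high i h)
  have hKi : K i = 2 ^ L * 2 ^ (L * L) := by simp only [K, log_eq_of_mem_block hi_block]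
  have hlong : K i ≤ l₀ g₀ := by
    rw [hg₀]
    refine hB i _ (le_natAbs_linearCombination ht hi (fun j hj => ?_) fun j _ => ?_)
    · by_contra h
      exact hj.not_ge (Finset.le_max' _ _ (Finsupp.mem_support_iff.2 h))
    · have h1 := e_le j
      have h2 := (Nat.le_mul_of_pos_right (m j).natAbs (blockWeight_pos j)).trans (m_le j).le
      rw [← hKi] at h2
      rw [Finsupp.sub_apply]
      omega
  omega

theorem exists_metric_of_central_not_isOfFinOrder {G : Type*} [Group G] [Countable G] {z : G}
    (hz : z ∈ Subgroup.center G) (hz' : ¬ IsOfFinOrder z) :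
    ∃ m : MetricSpace G, IsProperLeftInvariant m ∧ asdimAN m = ⊤ := by
  obtain ⟨l, t, hl, hlt⟩ := exists_isProperLength_hamming hz hz'
  refine ⟨hl.metric, hl.isProperLeftInvariant_metric,
    asdimAN_eq_top_of_hamming_cubes fun N => ⟨Finset.Ico (2 ^ N) (2 ^ (N + 1)), 2 ^ (N * N),
      fun x => z ^ Finsupp.linearCombination ℤ (fun j => (t j : ℤ)) (subsetIndicator x),
      ?_, ?_, fun x y => ?_⟩⟩
  · have := Nat.lt_two_pow_self (n := N)
    rw [Nat.card_Ico, pow_succ]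
    omega
  · exact (Nat.le_mul_self N).trans Nat.lt_two_pow_self.le
  · rw [hl.metric_dist, ← zpow_neg, ← zpow_add, neg_add_eq_sub, ← map_sub, hlt]
    push_cast
    rfl

/-! ### Elements of infinite order and conclusion -/

/-- A commutative group that is not locally finite has an element of infinite order. -/
theorem exists_not_isOfFinOrder_of_not_isLocallyFiniteGroup {H : Type*} [Group H]
    (hcomm : ∀ a b : H, a * b = b * a) (h : ¬ IsLocallyFiniteGroup H) : ∃ z : H, ¬ IsOfFinOrder z := by
  by_contra! htor
  refine h fun K hK => ?_
  let : CommGroup K :=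
    { (inferInstance : Group K) with mul_comm := fun a b => Subtype.ext (hcomm a b) }
  have : Group.FG K := (Group.fg_iff_subgroup_fg K).2 hK
  exact CommGroup.finite_of_fg_isMulTorsion K fun g =>
    Submonoid.isOfFinOrder_coe.1 (htor (g : H))

/-- Part 1 is the theorem. Part 2 is its consequence for the group `ℤ`: a proper left-invariant
metric on `ℤ` for which both questions of Dranishnikov have a negative answer, under either reading
of the dimension (Assouad-Nagata or asymptotic Assouad-Nagata). -/
theorem theorem4p2 :
    (∀ (G : Type u) [Group G] [Countable G],
      ¬ IsLocallyFiniteGroup (Subgroup.center G) →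
        ∃ m : MetricSpace G, IsProperLeftInvariant m ∧ asdimAN m = ⊤) ∧
    (∃ m : MetricSpace (Multiplicative ℤ), IsProperLeftInvariant m ∧
      asdimAN m = ⊤ ∧ dimAN m = ⊤ ∧
      ∀ (Γ : Type v) [Group Γ] [Countable Γ] (mΓ : MetricSpace Γ), IsProperLeftInvariant mΓ →
        (asdimAN mΓ ≠ ⊤ → asdimAN (prodMetric mΓ m) ≠ asdimAN mΓ + 1) ∧
        (dimAN mΓ ≠ ⊤ → dimAN (prodMetric mΓ m) ≠ dimAN mΓ + 1)) := by
  constructor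
  · intro G _ _ hG
    obtain ⟨z, hz⟩ := exists_not_isOfFinOrder_of_not_isLocallyFiniteGroup
      (fun a b => Subtype.ext (Subgroup.mem_center_iff.1 b.2 a)) hG
    exact exists_metric_of_central_not_isOfFinOrder z.2
      fun h => hz (Submonoid.isOfFinOrder_coe.1 h)
  · have hz : ¬ IsOfFinOrder (Multiplicative.ofAdd (1 : ℤ)) := by
      rw [← injective_zpow_iff_not_isOfFinOrder]
      intro a b hab
      simpa [← ofAdd_zsmul] using hab
    obtain ⟨m, hm, htop⟩ := exists_metric_of_central_not_isOfFinOrder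
      (Subgroup.mem_center_iff.2 fun g => mul_comm g (Multiplicative.ofAdd (1 : ℤ))) hz
    refine ⟨m, hm, htop, dimAN_eq_top_of_asdimAN_eq_top htop, fun Γ _ _ mΓ _ => ?_⟩
    have hprod : asdimAN (prodMetric mΓ m) = ⊤ :=
      asdimAN_eq_top_of_isometry (fun a => ((1 : Γ), a)) (prodMetric_dist_mk_left mΓ m 1) htop
    -- In `ℕ∞`, `⊤ = d + 1` forces `d = ⊤`.
    refine ⟨fun h => ?_, fun h => ?_⟩
    · rw [hprod]
      simp [eq_comm, h]
    · rw [dimAN_eq_top_of_asdimAN_eq_top hprod]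
      simp [eq_comm, h]
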